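/- Let $n,p\ge 1$ and let $\boldsymbol x_1,\dots,\boldsymbol x_n\in\mathbb R^p$ be a piecewise constant signal: there are $K\ge 1$ and integers $1=n_1<n_2<\dots<n_K<n_{K+1}=n+1$ such that $\boldsymbol x_i=\boldsymbol x_{j}$ whenever $n_k\le i,j\le n_{k+1}-1$ for some $1\le k\le K$. Put $m_k=n_{k+1}-n_k$, let $k(i)$ be the index with $n_{k(i)}\le i\le n_{k(i)+1}-1$, and let $$d_i=\min\bigl(i+1-n_{k(i)},\;n_{k(i)+1}-i\bigr).$$ We observe $\boldsymbol y_i=\boldsymbol x_i+\boldsymbol\epsilon_i$, $1\le i\le n$, where $\boldsymbol\epsilon_1,\dots,\boldsymbol\epsilon_n$ are independent, each with law $N(\mathbf 0,\sigma^2\mathbf I_{p\times p})$, $\sigma>0$. For $\lambda\in\mathbb R$ let $(\hat{\boldsymbol x}_1,\dots,\hat{\boldsymbol x}_n)$ be a solution of the group fused lasso problem, i.e. a minimizer over $(\boldsymbol z_1,\dots,\boldsymbol z_n)\in(\mathbb R^p)^n$ of $$\sum_{i=1}^n\|\boldsymbol y_i-\boldsymbol z_i\|^2+\lambda\sum_{i=1}^{n-1}\|\boldsymbol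 z_i-\boldsymbol z_{i+1}\|,$$ where $\|\cdot\|$ is the Euclidean norm. Let $t>0$, set $$M_y=\sigma\max\Bigl(\sqrt{8(\log n+\log t)+p},\;2\sqrt p\Bigr)$$ (with $\sqrt s:=0$ for $s<0$, which can only occur for $t<1$, where the claim is void), and assume $$25^2M_y\le\lambda<\min_{1\le k\le K}\bigl(7m_k-\sqrt{m_k}\bigr)M_y .$$ Then with probability at least $1-1/t^2$ the following holds simultaneously for all $1\le i\le n$: $$\|\hat{\boldsymbol x}_i-\boldsymbol x_i\|\le\max\left(\frac{4\bigl(M_y\sqrt{m_{k(i)}/2}+\lambda\bigr)}{m_{k(i)}},\;\frac{50M_y}{\sqrt{m_{k(i)}}},\;\frac{25\sqrt5\,M_y}{\sqrt{d_i}},\;125\sqrt{\frac{M_y^3}{\lambda}}\right).$$ -/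

import Mathlib

open MeasureTheory ProbabilityTheory

noncomputable section

/-- The group fused lasso objective
`∑ᵢ ‖yᵢ - zᵢ‖² + lam * ∑ᵢ ‖zᵢ - zᵢ₊₁‖` on sequences of `n` vectors of `ℝᵖ`
(indices run over `0, …, n - 1`). -/
def gflObjective {n p : ℕ} (lam : ℝ) (y z : Fin n → EuclideanSpace ℝ (Fin p)) : ℝ :=
  (∑ i : Fin n, ‖y i - z i‖ ^ 2) +
    lam * ∑ j : Fin (n - 1),
      ‖z ⟨j.val, by have := j.isLt; omega⟩ - z ⟨j.val + 1, by have := j.isLt; omega⟩‖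

/-- `z` is a solution of the group fused lasso problem with data `y`, i.e. a global minimizer
of the objective. -/
def IsGFLSolution {n p : ℕ} (lam : ℝ) (y z : Fin n → EuclideanSpace ℝ (Fin p)) : Prop :=
  ∀ w : Fin n → EuclideanSpace ℝ (Fin p), gflObjective lam y z ≤ gflObjective lam y w

/-- A division of the indices `0, …, n - 1` into `K ≥ 1` consecutive nonempty intervals; the
`k`-th interval consists of the `i` with `start k ≤ i < start (k + 1)`. -/
structure Segmentation (n K : ℕ) where
  start : Fin (K + 1) → ℕ
  start_strictMono : StrictMono start
  start_zero : start 0 = 0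
  start_last : start (Fin.last K) = n
  pos : 0 < K

namespace Segmentation

variable {n K : ℕ}

/-- The index `i` lies in the `k`-th interval. -/
def Mem (S : Segmentation n K) (k : Fin K) (i : Fin n) : Prop :=
  S.start k.castSucc ≤ i.val ∧ i.val < S.start k.succ

/-- The length `m_k` of the `k`-th interval. -/
def len (S : Segmentation n K) (k : Fin K) : ℕ := S.start k.succ - S.start k.castSucc

/-- For `i` in the `k`-th interval, `d_i` is the smaller of the numbers of indices of the interval
that are at most `i`, respectively at least `i`. -/
def dist (S : Segmentation n K) (k : Fin K) (i : Fin n) : ℕ :=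
  min (i.val + 1 - S.start k.castSucc) (S.start k.succ - i.val)

/-- The signal `x` is constant on each interval. -/
def IsConstOn {α : Type*} (S : Segmentation n K) (x : Fin n → α) : Prop :=
  ∀ (k : Fin K) (i j : Fin n), S.Mem k i → S.Mem k j → x i = x j

end Segmentation

/-- `M_y = σ max(√(8 (log n + log t) + p), 2 √p)`. -/
def gflNoiseLevel (n p : ℕ) (σ t : ℝ) : ℝ :=
  σ * max (√(8 * (Real.log n + Real.log t) + p)) (2 * √(p : ℝ))

/-- The bound on the error at an index at distance `d` from the ends of its interval of
length `m`. -/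
def gflBound (M lam : ℝ) (m d : ℕ) : ℝ :=
  max (max (4 * (M * √((m : ℝ) / 2) + lam) / m) (50 * M / √(m : ℝ)))
    (max (25 * √5 * M / √(d : ℝ)) (125 * √(M ^ 3 / lam)))

end

/-! Fix a block on which the signal is constant. Optimality says that the partial sums `D` of
estimate minus data stay in the ball of radius `lam / 2`, and that the estimate jumps only where `D`
is on the sphere, in the direction of `D`. If `S` denotes the partial sums of the errors, then `S -
D` is the accumulated noise: up to noise, `S` is a taut string. Dividing by `M` makes the noise over
`L` indices at most `√L` and the radius `r = lam / (2M) ≥ 625 / 2`.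

A large error is a fast step of `S`, whereas `S` can move by at most `2r` plus noise. A fast step
`e` forces a longer move (`no_fast_step`). If `D` does not point against `e`, the speed along `e`
persists afterwards (`persist_forward`). Otherwise it was already present before
(`persist_backward`), and the average speed then decays slowly (`average_growth`). Both decays are
paid for by the total jump, which `totalVariation_le` bounds by the first and last increments of a
window. These are comparable to `e` if `e` maximizes the ratio of error to claimed bound
(`norm_increment_le`).

The noise hypothesis holds with the required probability by a union bound over at most `n²`
intervals and the exponential moment `E exp(3‖g‖²/8) = 2 ^ p` of a standard Gaussian vector `g`. -/

open scoped InnerProductSpace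

/-! ### Taut paths: total variation and average speed -/

/-- Boundaries `0, …, m` of a block of `m` consecutive indices: `S` is the path of partial sums of
the estimation errors, `D` the path of dual variables, and `S - D` the path of partial sums of the
noise.  The increments of `S` only change, in the direction of `D j` and by the multiple `c j`,
at boundaries `j` where `D j` lies on the sphere of radius `r`. -/
structure TautPath {E : Type*} [NormedAddCommGroup E] [InnerProductSpace ℝ E]
    (r : ℝ) (m : ℕ) (S D : ℕ → E) (c : ℕ → ℝ) : Prop where
  norm_le : ∀ j ≤ m, ‖D j‖ ≤ r
  noise : ∀ a b, a ≤ b → b ≤ m → ‖(S b - S a) - (D b - D a)‖ ≤ √((b : ℝ) - a)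
  nonneg : ∀ j, 0 ≤ c j
  contact : ∀ j, c j * (‖D j‖ - r) = 0
  jump : ∀ j, j + 1 < m → (S (j + 2) - S (j + 1)) - (S (j + 1) - S j) = c (j + 1) • D (j + 1)

theorem sum_second_difference {E : Type*} [AddCommGroup E] (S : ℕ → E) (N : ℕ) :
    ∑ j ∈ Finset.range N, ((S (j + 2) - S (j + 1)) - (S (j + 1) - S j)) =
      (S (N + 1) - S N) - (S 1 - S 0) := by
  simpa using Finset.sum_range_sub (fun j => S (j + 1) - S j) N

namespace TautPath

variable {E : Type*} [NormedAddCommGroup E] [InnerProductSpace ℝ E]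
  {r : ℝ} {m : ℕ} {S D : ℕ → E} {c : ℕ → ℝ}

theorem shift (h : TautPath r m S D c) (a L : ℕ) (hL : a + L ≤ m) :
    TautPath r L (fun j => S (a + j)) (fun j => D (a + j)) (fun j => c (a + j)) where
  norm_le j hj := h.norm_le _ (by omega)
  noise i j hij hj := by
    have := h.noise (a + i) (a + j) (by omega) (by omega)
    push_cast at this
    simpa using this
  nonneg j := h.nonneg _
  contact j := h.contact _
  jump j hj := h.jump (a + j) (by omega)

/-- Reading the block from its other end keeps the increments but negates the jumps, hence the sign
of `D`. -/
theorem reverse (h : TautPath r m S D c) :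
    TautPath r m (fun j => -S (m - j)) (fun j => -D (m - j)) (fun j => c (m - j)) where
  norm_le j hj := by simpa using h.norm_le _ (by omega)
  noise a b hab hb := by
    have := h.noise (m - b) (m - a) (by omega) (by omega)
    rw [Nat.cast_sub (by omega), Nat.cast_sub (by omega)] at this
    convert this using 2
    · abel_nf
    · ring
  nonneg j := h.nonneg _
  contact j := by simpa using h.contact _
  jump j hj := by
    have := h.jump (m - (j + 2)) (by omega)
    rw [show m - (j + 2) + 2 = m - j by omega, show m - (j + 2) + 1 = m - (j + 1) by omega] at this
    rw [smul_neg, ← this]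
    abel

/-- Summation by parts. -/
theorem sum_inner_jump (S : ℕ → E) (N : ℕ) :
    ∑ j ∈ Finset.range N, ⟪(S (j + 2) - S (j + 1)) - (S (j + 1) - S j), S (j + 1) - S 0⟫_ℝ =
      ⟪S (N + 1) - S N, S N - S 0⟫_ℝ - ∑ k ∈ Finset.range N, ‖S (k + 1) - S k‖ ^ 2 := by
  induction N with
  | zero => simp
  | succ N ih =>
    rw [Finset.sum_range_succ, Finset.sum_range_succ, ih, ← real_inner_self_eq_norm_sq]
    have : S (N + 1) - S 0 = (S (N + 1) - S N) + (S N - S 0) := by abel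
    rw [this]
    simp only [inner_add_right, inner_sub_left]
    ring

theorem norm_jump (h : TautPath r m S D c) {j : ℕ} (hj : j + 1 < m) :
    ‖(S (j + 2) - S (j + 1)) - (S (j + 1) - S j)‖ = c (j + 1) * r := by
  rw [h.jump j hj, norm_smul, Real.norm_of_nonneg (h.nonneg _)]
  linarith [h.contact (j + 1)]

theorem radius_nonneg (h : TautPath r m S D c) : 0 ≤ r :=
  (norm_nonneg _).trans (h.norm_le 0 (Nat.zero_le _))

/-- The total variation of the increments is controlled by the first and the last one. -/
theorem totalVariation_le (h : TautPath r m S D c) {N : ℕ} (hN : N < m) :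
    (r - √(N : ℝ)) * ∑ j ∈ Finset.range N, c (j + 1) * r ≤
      (r + √(N : ℝ)) * ‖S (N + 1) - S N‖ + r * ‖S 1 - S 0‖ := by
  set J : ℕ → E := fun j => (S (j + 2) - S (j + 1)) - (S (j + 1) - S j) with hJ
  -- Up to noise, `S (j + 1) - S 0 + D 0` is `D (j + 1)`, which is parallel to the jump and has norm
  -- `r` wherever the jump is nonzero.
  have h1 : ∀ j ∈ Finset.range N, (r - √(N : ℝ)) * (c (j + 1) * r) ≤
      ⟪J j, S (j + 1) - S 0⟫_ℝ + ⟪J j, D 0⟫_ℝ := by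
    intro j hj
    rw [Finset.mem_range] at hj
    have hw := h.noise 0 (j + 1) (Nat.zero_le _) (by omega)
    set w := (S (j + 1) - S 0) - (D (j + 1) - D 0) with hwdef
    have e1 : S (j + 1) - S 0 = D (j + 1) - D 0 + w := by rw [hwdef]; abel
    have e2 : ⟪J j, D (j + 1)⟫_ℝ = r * (c (j + 1) * r) := by
      rw [hJ]; dsimp only
      rw [h.jump j (by omega), real_inner_smul_left, real_inner_self_eq_norm_sq]
      linear_combination (‖D (j + 1)‖ + r) * h.contact (j + 1)
    have e3 : -(‖J j‖ * ‖w‖) ≤ ⟪J j, w⟫_ℝ := by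
      have := abs_real_inner_le_norm (J j) w
      exact (abs_le.1 this).1
    have e4 : ‖J j‖ = c (j + 1) * r := h.norm_jump (by omega)
    have e5 : ‖w‖ ≤ √(N : ℝ) := hw.trans (Real.sqrt_le_sqrt (by
      push_cast; simp only [sub_zero]; exact_mod_cast hj))
    have e6 : ‖J j‖ * ‖w‖ ≤ (c (j + 1) * r) * √(N : ℝ) := by
      rw [e4]; exact mul_le_mul_of_nonneg_left e5 (mul_nonneg (h.nonneg _) h.radius_nonneg)
    rw [e1, inner_add_right, inner_sub_right, e2]
    linarith
  have h2 := Finset.sum_le_sum h1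
  rw [← Finset.mul_sum, Finset.sum_add_distrib, sum_inner_jump, ← sum_inner, sum_second_difference] at h2
  have h3 : 0 ≤ ∑ k ∈ Finset.range N, ‖S (k + 1) - S k‖ ^ 2 :=
    Finset.sum_nonneg fun _ _ => sq_nonneg _
  have h4 : S N - S 0 + D 0 = D N + ((S N - S 0) - (D N - D 0)) := by abel
  have h5 : ⟪S (N + 1) - S N, S N - S 0⟫_ℝ + ⟪S (N + 1) - S N, D 0⟫_ℝ ≤
      ‖S (N + 1) - S N‖ * (r + √(N : ℝ)) := by
    rw [← inner_add_right, h4]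
    refine (real_inner_le_norm _ _).trans (mul_le_mul_of_nonneg_left ?_ (norm_nonneg _))
    refine (norm_add_le _ _).trans (add_le_add (h.norm_le _ (by omega)) ?_)
    simpa using h.noise 0 N (Nat.zero_le _) (by omega)
  have h6 : -(‖S 1 - S 0‖ * r) ≤ ⟪S 1 - S 0, D 0⟫_ℝ := by
    have := (abs_le.1 (abs_real_inner_le_norm (S 1 - S 0) (D 0))).1
    have := mul_le_mul_of_nonneg_left (h.norm_le 0 (Nat.zero_le _)) (norm_nonneg (S 1 - S 0))
    linarith
  rw [inner_sub_left (S (N + 1) - S N)] at h2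
  linarith

/-- A nonzero jump points along `D (j + 1)` on the sphere, so it pairs nonnegatively with `D (j + 1)
- D 0`, as `D 0` is in the ball. Only noise can make the pairing with `S (j + 1) - S 0` negative.
Summation by parts and Cauchy–Schwarz do the rest. -/
theorem inner_increment_ge (h : TautPath r m S D c) {N : ℕ} (hN : N < m) (hN0 : 0 < N) :
    ‖S N - S 0‖ ^ 2 / N - √(N : ℝ) * ∑ j ∈ Finset.range N, c (j + 1) * r ≤
      ⟪S (N + 1) - S N, S N - S 0⟫_ℝ := by
  have h1 : ∀ j ∈ Finset.range N, -√(N : ℝ) * (c (j + 1) * r) ≤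
      ⟪(S (j + 2) - S (j + 1)) - (S (j + 1) - S j), S (j + 1) - S 0⟫_ℝ := by
    intro j hj
    rw [Finset.mem_range] at hj
    have hw := h.noise 0 (j + 1) (Nat.zero_le _) (by omega)
    set w := (S (j + 1) - S 0) - (D (j + 1) - D 0) with hwdef
    have e1 : S (j + 1) - S 0 = D (j + 1) - D 0 + w := by rw [hwdef]; abel
    have e5 : ‖w‖ ≤ √(N : ℝ) := hw.trans (Real.sqrt_le_sqrt (by
      push_cast; simp only [sub_zero]; exact_mod_cast hj))
    have hc := h.nonneg (j + 1)
    rw [h.jump j (by omega), real_inner_smul_left, e1, inner_add_right, inner_sub_right,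
      real_inner_self_eq_norm_sq]
    have e2 : ⟪D (j + 1), D 0⟫_ℝ ≤ ‖D (j + 1)‖ * r := (real_inner_le_norm _ _).trans
      (mul_le_mul_of_nonneg_left (h.norm_le 0 (Nat.zero_le _)) (norm_nonneg _))
    have e3 : -(‖D (j + 1)‖ * √(N : ℝ)) ≤ ⟪D (j + 1), w⟫_ℝ := by
      have := (abs_le.1 (abs_real_inner_le_norm (D (j + 1)) w)).1
      have := mul_le_mul_of_nonneg_left e5 (norm_nonneg (D (j + 1)))
      linarith
    have e4 : c (j + 1) * (‖D (j + 1)‖ ^ 2 - ‖D (j + 1)‖ * r - ‖D (j + 1)‖ * √(N : ℝ)) ≤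
        c (j + 1) * (‖D (j + 1)‖ ^ 2 - ⟪D (j + 1), D 0⟫_ℝ + ⟪D (j + 1), w⟫_ℝ) :=
      mul_le_mul_of_nonneg_left (by linarith) hc
    have e6 : c (j + 1) * (‖D (j + 1)‖ ^ 2 - ‖D (j + 1)‖ * r - ‖D (j + 1)‖ * √(N : ℝ)) =
        -√(N : ℝ) * (c (j + 1) * r) := by
      linear_combination (‖D (j + 1)‖ - √(N : ℝ)) * h.contact (j + 1)
    linarith
  have h2 := Finset.sum_le_sum h1
  rw [← Finset.mul_sum, sum_inner_jump] at h2
  have h3 : ‖S N - S 0‖ ^ 2 ≤ N * ∑ k ∈ Finset.range N, ‖S (k + 1) - S k‖ ^ 2 := by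
    have e1 : ‖S N - S 0‖ ≤ ∑ k ∈ Finset.range N, ‖S (k + 1) - S k‖ := by
      rw [← Finset.sum_range_sub]; exact norm_sum_le _ _
    have e2 := sq_sum_le_card_mul_sum_sq (s := Finset.range N) (f := fun k => ‖S (k + 1) - S k‖)
    rw [Finset.card_range] at e2
    exact (pow_le_pow_left₀ (norm_nonneg _) e1 2).trans e2
  have h4 : ‖S N - S 0‖ ^ 2 / N ≤ ∑ k ∈ Finset.range N, ‖S (k + 1) - S k‖ ^ 2 := by
    rw [div_le_iff₀' (by exact_mod_cast hN0)]; exact h3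
  linarith

theorem sum_jump_le_of_le (h : TautPath r m S D c) {N N' : ℕ} (hN : N ≤ N') :
    ∑ j ∈ Finset.range N, c (j + 1) * r ≤ ∑ j ∈ Finset.range N', c (j + 1) * r :=
  Finset.sum_le_sum_of_subset_of_nonneg (Finset.range_mono hN)
    fun _ _ _ => mul_nonneg (h.nonneg _) h.radius_nonneg

theorem inv_sq_mul_le {a b : ℝ} (ha : 0 < a) (hb : 0 < b) (h : b ^ 2 = a ^ 2 + 1) :
    1 / (b ^ 2 * a) ≤ 2 * (1 / a - 1 / b) := by
  rw [← sub_nonneg]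
  have : 2 * (1 / a - 1 / b) - 1 / (b ^ 2 * a) = (2 * (b * (b - a)) - 1) / (b ^ 2 * a) := by
    field_simp
  rw [this]
  apply div_nonneg _ (by positivity)
  nlinarith [sq_nonneg (b - a)]

/-- Makes the successive losses of average speed in `average_growth` telescope. -/
theorem inv_succ_mul_sqrt_le {p : ℝ} (hp : 0 < p) :
    1 / ((p + 1) * √p) ≤ 2 * (1 / √p - 1 / √(p + 1)) := by
  have h1 : √(p + 1) ^ 2 = p + 1 := Real.sq_sqrt (by linarith)
  have := inv_sq_mul_le (Real.sqrt_pos.2 hp) (Real.sqrt_pos.2 (show 0 < p + 1 by linarith))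
    (by rw [h1, Real.sq_sqrt hp.le])
  rwa [h1] at this

/-- The average speed of the path decreases slowly. -/
theorem average_growth (h : TautPath r m S D c) {β T : ℝ} (hβ : 0 < β) {δ : ℕ} (hδ : 0 < δ)
    (hT : ∑ j ∈ Finset.range (m - 1), c (j + 1) * r ≤ T)
    (hstart : δ * (β + 2 * T / β / √(δ : ℝ)) ≤ ‖S δ - S 0‖) {p : ℕ} (hδp : δ ≤ p) (hp : p ≤ m) :
    p * (β + 2 * T / β / √(p : ℝ)) ≤ ‖S p - S 0‖ := by
  have hT0 : 0 ≤ T := (Finset.sum_nonneg fun _ _ => mul_nonneg (h.nonneg _) h.radius_nonneg).trans hT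
  induction p, hδp using Nat.le_induction with
  | base => exact hstart
  | succ p hδp ih =>
    have ih := ih (by omega)
    have hp0 : (0 : ℝ) < p := by exact_mod_cast (by omega : 0 < p)
    set X := ‖S p - S 0‖ with hX
    have hXβ : p * β ≤ X := le_trans (mul_le_mul_of_nonneg_left
      (le_add_of_nonneg_right (by positivity)) hp0.le) ih
    have hXpos : 0 < X := lt_of_lt_of_le (by positivity) hXβ
    have h1 := h.inner_increment_ge (N := p) (by omega) (by omega)
    have h2 : √(p : ℝ) * ∑ j ∈ Finset.range p, c (j + 1) * r ≤ √(p : ℝ) * T :=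
      mul_le_mul_of_nonneg_left ((h.sum_jump_le_of_le (by omega)).trans hT) (Real.sqrt_nonneg _)
    have h3 : ⟪S (p + 1) - S p, S p - S 0⟫_ℝ + X ^ 2 ≤ ‖S (p + 1) - S 0‖ * X := by
      rw [hX, ← real_inner_self_eq_norm_sq, ← inner_add_left, sub_add_sub_cancel]
      exact real_inner_le_norm _ _
    -- From `p` to `p + 1` the average speed loses at most `√p * T / (X * (p + 1))`, hence at most
    -- `T / (β * √p * (p + 1))` since `X ≥ p * β`.
    have h4 : X * (X * (p + 1) / p) - √(p : ℝ) * T ≤ X * ‖S (p + 1) - S 0‖ := by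
      have : X * (X * (p + 1) / p) = X ^ 2 / p + X ^ 2 := by
        field_simp
        ring
      linarith
    have h5 : X * (p + 1) / p - √(p : ℝ) * T / X ≤ ‖S (p + 1) - S 0‖ := by
      rw [← mul_le_mul_iff_right₀ hXpos]
      refine le_trans (le_of_eq ?_) h4
      field_simp
    have h6 : √(p : ℝ) * T / X ≤ √(p : ℝ) * T / (p * β) :=
      div_le_div_of_nonneg_left (by positivity) (by positivity) hXβ
    have h7 : (p + 1) * (β + 2 * T / β / √(p : ℝ)) ≤ X * (p + 1) / p := by
      rw [le_div_iff₀ hp0]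
      nlinarith
    have h8 := inv_succ_mul_sqrt_le hp0
    have h9 : √(p : ℝ) * T / (p * β) = (p + 1) * (T / β) * (1 / ((p + 1) * √(p : ℝ))) := by
      have := Real.sq_sqrt hp0.le
      have h0 := Real.sqrt_pos.2 hp0
      field_simp
      rw [this, mul_comm]
    have h10 : (p + 1) * (T / β) * (1 / ((p + 1) * √(p : ℝ))) ≤
        (p + 1) * (T / β) * (2 * (1 / √(p : ℝ) - 1 / √((p : ℝ) + 1))) :=
      mul_le_mul_of_nonneg_left h8 (by positivity)
    push_cast
    have h11 : (p + 1) * (T / β) * (2 * (1 / √(p : ℝ) - 1 / √((p : ℝ) + 1))) =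
        (p + 1) * (β + 2 * T / β / √(p : ℝ)) - (p + 1) * (β + 2 * T / β / √((p : ℝ) + 1)) := by
      ring
    linarith

end TautPath

/-! ### Persistence of a fast step -/

namespace TautPath

variable {E : Type*} [NormedAddCommGroup E] [InnerProductSpace ℝ E]
  {r : ℝ} {m : ℕ} {S D : ℕ → E} {c : ℕ → ℝ}

theorem norm_sub_le (h : TautPath r m S D c) {a b : ℕ} (hab : a ≤ b) (hb : b ≤ m) :
    ‖S b - S a‖ ≤ 2 * r + √(m : ℝ) := by
  have h1 : S b - S a = D b - D a + ((S b - S a) - (D b - D a)) := by abel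
  have h2 := (h.noise a b hab hb).trans (Real.sqrt_le_sqrt (show (b : ℝ) - a ≤ m by
    have : (b : ℝ) ≤ m := by exact_mod_cast hb
    have : (0 : ℝ) ≤ a := Nat.cast_nonneg a
    linarith))
  have h3 := _root_.norm_sub_le (D b) (D a)
  have h4 := h.norm_le b hb
  have h5 := h.norm_le a (hab.trans hb)
  rw [h1]
  linarith [norm_add_le (D b - D a) ((S b - S a) - (D b - D a))]

theorem abs_noise_inner_le (h : TautPath r m S D c) {a b : ℕ} (hab : a ≤ b) (hb : b ≤ m) (e : E) :
    |⟪S b - S a, e⟫_ℝ - (⟪D b, e⟫_ℝ - ⟪D a, e⟫_ℝ)| ≤ ‖e‖ * √((b : ℝ) - a) := by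
  rw [← inner_sub_left, ← inner_sub_left, mul_comm]
  exact (abs_real_inner_le_norm _ _).trans
    (mul_le_mul_of_nonneg_right (h.noise a b hab hb) (norm_nonneg _))

/-- If the dual variable does not point backwards at the end of step `s`, then the speed in the
direction of step `s` persists after it. -/
theorem persist_forward (h : TautPath r m S D c) {s : ℕ} {v : ℝ}
    (hes : ‖S (s + 1) - S s‖ = v) (hf : -(1 / 4) ≤ ⟪D (s + 1), S (s + 1) - S s⟫_ℝ)
    (hT : (3 / 5 : ℝ) * ∑ j ∈ Finset.range (m - 1), c (j + 1) ≤ v ^ 2 / 10) (k : ℕ)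
    (hk : s + k < m) :
    v ^ 2 - (3 / 5 : ℝ) * ∑ j ∈ Finset.range k, c (s + j + 1) ≤
        ⟪S (s + k + 1) - S (s + k), S (s + 1) - S s⟫_ℝ ∧
      (9 / 10 : ℝ) * v ^ 2 * k ≤ ⟪S (s + k + 1) - S (s + 1), S (s + 1) - S s⟫_ℝ := by
  induction k with
  | zero => simp [hes]
  | succ k ih =>
    obtain ⟨ih1, ih2⟩ := ih (by omega)
    set e := S (s + 1) - S s with he
    have hn := (abs_le.1 (h.abs_noise_inner_le (a := s + 1) (b := s + k + 1) (by omega) (by omega)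
      e)).2
    have hcast : ((s + k + 1 : ℕ) : ℝ) - ((s + 1 : ℕ) : ℝ) = k := by push_cast; ring
    rw [hcast, hes] at hn
    -- With `x = v * √k`, `D` has gained at least `9/10 x² - x ≥ -5/18` along `e`, and `-1/4 - 5/18
    -- > -3/5`.
    have hfk : -(3 / 5 : ℝ) ≤ ⟪D (s + k + 1), e⟫_ℝ := by
      have := Real.sq_sqrt (Nat.cast_nonneg (α := ℝ) k)
      nlinarith [sq_nonneg (v * √(k : ℝ) - 5 / 9)]
    have hj := h.jump (s + k) (by omega)
    have hg : ⟪S (s + (k + 1) + 1) - S (s + (k + 1)), e⟫_ℝ =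
        ⟪S (s + k + 1) - S (s + k), e⟫_ℝ + c (s + k + 1) * ⟪D (s + k + 1), e⟫_ℝ := by
      rw [← real_inner_smul_left, ← inner_add_left, ← hj]
      congr 1
      rw [show s + (k + 1) + 1 = s + k + 2 by ring, show s + (k + 1) = s + k + 1 by ring]
      abel
    have hc := mul_le_mul_of_nonneg_left hfk (h.nonneg (s + k + 1))
    have hg1 : v ^ 2 - (3 / 5 : ℝ) * ∑ j ∈ Finset.range (k + 1), c (s + j + 1) ≤
        ⟪S (s + (k + 1) + 1) - S (s + (k + 1)), e⟫_ℝ := by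
      rw [Finset.sum_range_succ, hg]
      linarith
    have hsum : ∑ j ∈ Finset.range (k + 1), c (s + j + 1) ≤
        ∑ j ∈ Finset.range (m - 1), c (j + 1) := by
      calc _ ≤ ∑ j ∈ Finset.range s, c (j + 1) + ∑ j ∈ Finset.range (k + 1), c (s + j + 1) :=
            le_add_of_nonneg_left (Finset.sum_nonneg fun _ _ => h.nonneg _)
        _ = ∑ j ∈ Finset.range (s + (k + 1)), c (j + 1) :=
            (Finset.sum_range_add (fun j => c (j + 1)) s (k + 1)).symm
        _ ≤ _ := Finset.sum_le_sum_of_subset_of_nonneg (Finset.range_mono (by omega))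
            fun _ _ _ => h.nonneg _
    refine ⟨hg1, ?_⟩
    have hS : S (s + (k + 1) + 1) - S (s + 1) =
        (S (s + (k + 1) + 1) - S (s + (k + 1))) + (S (s + k + 1) - S (s + 1)) := by
      rw [show s + (k + 1) = s + k + 1 by ring]; abel
    rw [hS, inner_add_left]
    push_cast
    linarith

/-- If the dual variable points backwards at the end of step `s`, then the speed in the direction
of step `s` is at least as large at all earlier times. -/
theorem persist_backward (h : TautPath r m S D c) {s : ℕ} {v : ℝ} (hs : s < m)
    (hes : ‖S (s + 1) - S s‖ = v) (hf : ⟪D (s + 1), S (s + 1) - S s⟫_ℝ ≤ -(1 / 4)) (k : ℕ)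
    (hk : k ≤ s) :
    v ^ 2 ≤ ⟪S (s - k + 1) - S (s - k), S (s + 1) - S s⟫_ℝ ∧
      v ^ 2 * (k + 1) ≤ ⟪S (s + 1) - S (s - k), S (s + 1) - S s⟫_ℝ := by
  induction k with
  | zero => simp [hes]
  | succ k ih =>
    obtain ⟨ih1, ih2⟩ := ih (by omega)
    set e := S (s + 1) - S s with he
    obtain ⟨l, rfl⟩ : ∃ l, s = l + (k + 1) := ⟨s - (k + 1), by omega⟩
    rw [show l + (k + 1) - k = l + 1 by omega] at ih1 ih2
    rw [show l + (k + 1) - (k + 1) = l by omega]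
    have hn := (abs_le.1 (h.abs_noise_inner_le (a := l + 1) (b := l + (k + 1) + 1) (by omega)
      (by omega) e)).2
    have hcast : ((l + (k + 1) + 1 : ℕ) : ℝ) - ((l + 1 : ℕ) : ℝ) = k + 1 := by push_cast; ring
    rw [hcast, hes] at hn
    -- With `x = v * √(k + 1)` the pairing is at most `-1/4 - x² + x ≤ 0`.
    have hfk : ⟪D (l + 1), e⟫_ℝ ≤ 0 := by
      have := Real.sq_sqrt (show (0 : ℝ) ≤ k + 1 by positivity)
      nlinarith [sq_nonneg (v * √((k : ℝ) + 1) - 1 / 2)]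
    have hj := h.jump l (by omega)
    have hg : ⟪S (l + 1 + 1) - S (l + 1), e⟫_ℝ =
        ⟪S (l + 1) - S l, e⟫_ℝ + c (l + 1) * ⟪D (l + 1), e⟫_ℝ := by
      rw [← real_inner_smul_left, ← inner_add_left, ← hj]
      congr 1
      abel
    have hc := mul_nonpos_of_nonneg_of_nonpos (h.nonneg (l + 1)) hfk
    have hg1 : v ^ 2 ≤ ⟪S (l + 1) - S l, e⟫_ℝ := by linarith
    refine ⟨hg1, ?_⟩
    have hS : S (l + (k + 1) + 1) - S l =
        (S (l + (k + 1) + 1) - S (l + 1)) + (S (l + 1) - S l) := by abel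
    rw [hS, inner_add_left]
    push_cast
    linarith

/-- A step of size `v` which is long enough ago from the start for the noise to be negligible,
and long enough before the end for the path to leave the ball at speed `v`, is impossible. -/
theorem no_fast_step (h : TautPath r m S D c) {s : ℕ} {v : ℝ} (hv : 0 < v) (hs : s < m)
    (hes : ‖S (s + 1) - S s‖ = v) (hr : 625 / 2 ≤ r) (hvr : 3125 / 2 ≤ v * r)
    (hstart : 3125 / 2 ≤ v ^ 2 * (s + 1)) (hend : 29 / 10 * r ≤ v * ((m : ℝ) - s))
    (hm : √(m : ℝ) ≤ 51 / 1000 * r) (hfirst : ‖S 1 - S 0‖ ≤ 1415 / 1000 * v)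
    (hlast : ‖S m - S (m - 1)‖ ≤ 2 * v) : False := by
  have hr0 : 0 < r := by linarith
  -- `(1.051 * 2 + 1.415) / 0.949 < 3.71`.
  have hT : ∑ j ∈ Finset.range (m - 1), c (j + 1) * r ≤ 371 / 100 * v := by
    have h1 := h.totalVariation_le (N := m - 1) (by omega)
    rw [show m - 1 + 1 = m by omega] at h1
    have h2 : √((m - 1 : ℕ) : ℝ) ≤ 51 / 1000 * r :=
      (Real.sqrt_le_sqrt (by exact_mod_cast Nat.sub_le m 1)).trans hm
    set q := √((m - 1 : ℕ) : ℝ)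
    set T := ∑ j ∈ Finset.range (m - 1), c (j + 1) * r
    have hT0 : 0 ≤ T := Finset.sum_nonneg fun _ _ => mul_nonneg (h.nonneg _) hr0.le
    have h3 : (949 / 1000 * r) * T ≤ (r - q) * T := mul_le_mul_of_nonneg_right (by linarith) hT0
    have h4 : (r + q) * ‖S m - S (m - 1)‖ ≤ (1051 / 1000 * r) * (2 * v) :=
      mul_le_mul (by linarith) hlast (norm_nonneg _) (by positivity)
    have h5 : r * ‖S 1 - S 0‖ ≤ r * (1415 / 1000 * v) := mul_le_mul_of_nonneg_left hfirst hr0.le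
    have h6 : r * (949 / 1000 * T) ≤ r * (3517 / 1000 * v) := by linarith
    have h7 := le_of_mul_le_mul_left h6 hr0
    linarith
  -- The path moves by at most `2.051 * r`. Persistence forward yields `0.9 * 2.9 * r`, and average
  -- speed `0.71 * v` yields `0.71 * 2.9 * r`; both are larger.
  rcases le_total (-(1 / 4)) ⟪D (s + 1), S (s + 1) - S s⟫_ℝ with hf | hf
  · have hc : (3 / 5 : ℝ) * ∑ j ∈ Finset.range (m - 1), c (j + 1) ≤ v ^ 2 / 10 := by
      rw [← Finset.sum_mul] at hT
      set T := ∑ j ∈ Finset.range (m - 1), c (j + 1)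
      have h1 : r * (3 / 5 * T) ≤ r * (v ^ 2 / 10) := by nlinarith
      exact le_of_mul_le_mul_left h1 hr0
    have h1 := (h.persist_forward hes hf hc (m - 1 - s) (by omega)).2
    rw [show s + (m - 1 - s) + 1 = m by omega] at h1
    have hcast : ((m - 1 - s : ℕ) : ℝ) = m - s - 1 := by
      rw [Nat.sub_sub, Nat.cast_sub (by omega)]; push_cast; ring
    rw [hcast] at h1
    have h2 : ⟪S m - S s, S (s + 1) - S s⟫_ℝ =
        ⟪S m - S (s + 1), S (s + 1) - S s⟫_ℝ + v ^ 2 := by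
      rw [← hes, ← real_inner_self_eq_norm_sq, ← inner_add_left, sub_add_sub_cancel]
    have h3 := real_inner_le_norm (S m - S s) (S (s + 1) - S s)
    have h4 := h.norm_sub_le hs.le le_rfl
    rw [hes] at h3
    have h5 : ‖S m - S s‖ * v ≤ (2051 / 1000 * r) * v :=
      mul_le_mul_of_nonneg_right (by linarith) hv.le
    have h6 : v * (9 / 10 * (v * ((m : ℝ) - s))) ≤ v * (2051 / 1000 * r) := by nlinarith
    have h7 := le_of_mul_le_mul_left h6 hv
    linarith
  · have h1 := (h.persist_backward hs hes hf s le_rfl).2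
    rw [Nat.sub_self] at h1
    have h2 := real_inner_le_norm (S (s + 1) - S 0) (S (s + 1) - S s)
    rw [hes] at h2
    have h3 : (s + 1) * v ≤ ‖S (s + 1) - S 0‖ := by
      have : v * ((s + 1) * v) ≤ v * ‖S (s + 1) - S 0‖ := by linarith
      exact le_of_mul_le_mul_left this hv
    -- The margin `1 - 0.71` pays for the decay term, because `37² < 3125 / 2`.
    have h4 : 2 * (371 / 100 * v) / (71 / 100 * v) / √((s : ℝ) + 1) ≤ 29 / 100 * v := by
      have hq : 0 < √((s : ℝ) + 1) := Real.sqrt_pos.2 (by positivity)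
      have hq2 := Real.sq_sqrt (show (0 : ℝ) ≤ s + 1 by positivity)
      rw [div_div, div_le_iff₀ (by positivity)]
      have : 37 ≤ v * √((s : ℝ) + 1) := by
        apply le_of_sq_le_sq _ (by positivity)
        rw [mul_pow, hq2]
        linarith
      nlinarith
    have h5 := h.average_growth (β := 71 / 100 * v) (T := 371 / 100 * v) (δ := s + 1) (p := m)
      (by positivity) (by omega) hT ?_ (by omega) le_rfl
    · have h6 := h.norm_sub_le (Nat.zero_le m) le_rfl
      have h7 : 0 ≤ 2 * (371 / 100 * v) / (71 / 100 * v) / √(m : ℝ) := by positivity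
      have h8 : (m : ℝ) * (71 / 100 * v) ≤ 2051 / 1000 * r := by
        have := mul_le_mul_of_nonneg_left (le_add_of_nonneg_right h7 (a := 71 / 100 * v))
          (Nat.cast_nonneg (α := ℝ) m)
        linarith
      have h9 : 0 ≤ v * (s : ℝ) := by positivity
      linarith
    · push_cast
      refine le_trans (mul_le_mul_of_nonneg_left (by linarith) (by positivity)) h3

end TautPath

/-! ### Comparison of the bounds and the maximal step -/

theorem gflBound_one (r : ℝ) (m d : ℕ) :
    gflBound 1 (2 * r) m d = max (max (4 * (√((m : ℝ) / 2) + 2 * r) / m) (50 / √(m : ℝ)))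
      (max (25 * √5 / √(d : ℝ)) (125 * √(1 / (2 * r)))) := by
  simp [gflBound]

theorem gflBound_pos {r : ℝ} (hr : 0 < r) (m d : ℕ) : 0 < gflBound 1 (2 * r) m d := by
  rw [gflBound_one]
  exact lt_max_of_lt_right (lt_max_of_lt_right (by positivity))

/-- Only one term depends on `d`, and it scales like `1 / √d`. -/
theorem gflBound_le_mul {r q : ℝ} (hr : 0 < r) (hq : 1 ≤ q) {m d d' : ℕ} (hd : 0 < d)
    (hd' : 0 < d') (h : (d : ℝ) ≤ q ^ 2 * d') :
    gflBound 1 (2 * r) m d' ≤ q * gflBound 1 (2 * r) m d := by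
  have hB := gflBound_pos hr m d
  have hle : gflBound 1 (2 * r) m d ≤ q * gflBound 1 (2 * r) m d := le_mul_of_one_le_left hB.le hq
  have h1 : 25 * √5 / √(d' : ℝ) ≤ q * (25 * √5 / √(d : ℝ)) := by
    have e1 : 0 < √(d : ℝ) := Real.sqrt_pos.2 (by exact_mod_cast hd)
    have e2 : 0 < √(d' : ℝ) := Real.sqrt_pos.2 (by exact_mod_cast hd')
    have e3 : √(d : ℝ) ≤ q * √(d' : ℝ) := by
      rw [← Real.sqrt_sq (by linarith : 0 ≤ q), ← Real.sqrt_mul (sq_nonneg q)]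
      exact Real.sqrt_le_sqrt h
    rw [← mul_div_assoc, div_le_div_iff₀ e2 e1]
    have := mul_le_mul_of_nonneg_left e3 (show 0 ≤ 25 * √5 by positivity)
    linarith
  rw [gflBound_one r m d', max_le_iff, max_le_iff, max_le_iff]
  refine ⟨⟨hle.trans' ?_, hle.trans' ?_⟩, ?_, hle.trans' ?_⟩
  · rw [gflBound_one]; exact (le_max_left _ _).trans (le_max_left _ _)
  · rw [gflBound_one]; exact (le_max_right _ _).trans (le_max_left _ _)
  · refine h1.trans (mul_le_mul_of_nonneg_left ?_ (by linarith))
    rw [gflBound_one]; exact (le_max_left _ _).trans (le_max_right _ _)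
  · rw [gflBound_one]; exact (le_max_right _ _).trans (le_max_right _ _)

namespace TautPath

variable {E : Type*} [NormedAddCommGroup E] [InnerProductSpace ℝ E]
  {r : ℝ} {m : ℕ} {S D : ℕ → E} {c : ℕ → ℝ}

/-- `no_fast_step` is applied to a window around `i`: `δ` steps up to and including step `i` make
the noise negligible at speed `v`, and about `2.9 * r / v` steps from `i` on leave the ball. -/
theorem no_maximal_fast_step (h : TautPath r m S D c) {i : ℕ} {v : ℝ} (hi : 2 * i + 1 ≤ m)
    (hes : ‖S (i + 1) - S i‖ = v) (hr : 625 / 2 ≤ r) (hv1 : 3125 < v ^ 2 * (i + 1))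
    (hv2 : 15625 < v ^ 2 * (2 * r)) (hv3 : 8 * r < v * m)
    (hmax : ∀ k < m, ∀ q : ℝ, 1 ≤ q → ((i + 1 : ℕ) : ℝ) ≤ q ^ 2 * (min (k + 1) (m - k) : ℕ) →
      ‖S (k + 1) - S k‖ ≤ q * v) : False := by
  have hr0 : 0 < r := by linarith
  have hv : 0 < v := by
    rcases (hes ▸ norm_nonneg _ : 0 ≤ v).eq_or_lt with h0 | h0
    · rw [← h0] at hv2; norm_num at hv2
    · exact h0
  -- `15625 / 2 * (625 / 2) = (3125 / 2)²`.
  have hvr : 3125 / 2 ≤ v * r := by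
    apply le_of_sq_le_sq _ (by positivity)
    nlinarith
  set δ := ⌈3125 / 2 / v ^ 2⌉₊ with hδ
  set N := ⌈29 / 10 * r / v⌉₊ with hN
  have hδ0 : 0 < δ := Nat.ceil_pos.2 (by positivity)
  have hN0 : 0 < N := Nat.ceil_pos.2 (by positivity)
  have hδ1 : (δ : ℝ) < 3125 / 2 / v ^ 2 + 1 := Nat.ceil_lt_add_one (by positivity)
  have hN1 : (N : ℝ) < 29 / 10 * r / v + 1 := Nat.ceil_lt_add_one (by positivity)
  have hδ2 : 3125 / 2 / v ^ 2 ≤ (δ : ℝ) := Nat.le_ceil _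
  have hN2 : 29 / 10 * r / v ≤ (N : ℝ) := Nat.le_ceil _
  have hδi : 2 * δ ≤ i + 2 := by
    have e1 : 3125 / 2 / v ^ 2 ≤ ((i : ℝ) + 1) / 2 := by
      rw [div_le_iff₀ (by positivity)]; linarith
    have : (2 * δ : ℝ) < i + 3 := by linarith
    have : 2 * δ < i + 3 := by exact_mod_cast this
    omega
  have hrv : r / v ≤ m / 8 := by
    rw [div_le_iff₀ hv]; linarith
  have hNm : 4 * (i + N) + (i + 1) ≤ 4 * (m + 1) := by
    have e1 : 29 / 10 * r / v = 29 / 10 * (r / v) := by ring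
    have e2 : (2 * i + 1 : ℝ) ≤ m := by exact_mod_cast hi
    have : (4 * (i + N) + (i + 1) : ℝ) ≤ 4 * (m + 1) := by linarith
    exact_mod_cast this
  obtain ⟨s, hs⟩ : ∃ s, δ = s + 1 := ⟨δ - 1, by omega⟩
  obtain ⟨a, ha⟩ : ∃ a, i = a + s := ⟨i - s, by omega⟩
  have hw := h.shift a (s + N) (by omega)
  rw [hs] at hδ1 hδ2
  push_cast at hδ1 hδ2
  refine hw.no_fast_step (s := s) (v := v) hv (by omega) ?_ hr hvr ?_ ?_ ?_ ?_ ?_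
  · rw [← hes, ha]; simp only [add_assoc]
  · rw [div_le_iff₀ (by positivity)] at hδ2; linarith
  · rw [div_le_iff₀ hv] at hN2
    push_cast
    linarith
  · apply Real.sqrt_le_iff.2 ⟨by positivity, ?_⟩
    push_cast
    have e1 : r / v ≤ r ^ 2 / (3125 / 2) := by
      rw [div_le_div_iff₀ hv (by norm_num)]; nlinarith
    have e2 : 3125 / 2 / v ^ 2 ≤ r / v := by
      rw [div_le_div_iff₀ (by positivity) hv]; nlinarith
    have e3 : 29 / 10 * r / v = 29 / 10 * (r / v) := by ring
    nlinarith
  -- The first step of the window is at least half as far from the ends as `i`, and the last step at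
  -- least a quarter; hence the factors `1.415 > √2` and `2`.
  · have := hmax a (by omega) (1415 / 1000) (by norm_num) ?_
    · simpa using this
    · have : (i + 1 : ℕ) ≤ 2 * (min (a + 1) (m - a)) := by omega
      have e1 : ((i + 1 : ℕ) : ℝ) ≤ 2 * (min (a + 1) (m - a) : ℕ) := by exact_mod_cast this
      have e2 : (0 : ℝ) ≤ (min (a + 1) (m - a) : ℕ) := Nat.cast_nonneg _
      linarith
  · have := hmax (a + (s + N - 1)) (by omega) 2 (by norm_num) ?_
    · rwa [show a + (s + N - 1) + 1 = a + (s + N) by omega] at this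
    · have : (i + 1 : ℕ) ≤ 4 * (min (a + (s + N - 1) + 1) (m - (a + (s + N - 1)))) := by omega
      have e1 : ((i + 1 : ℕ) : ℝ) ≤ 4 * (min (a + (s + N - 1) + 1) (m - (a + (s + N - 1))) : ℕ) := by
        exact_mod_cast this
      linarith

/-- The estimation error at index `i` of a block of length `m`, for noise of size `1`. -/
theorem norm_increment_le (h : TautPath r m S D c) (hr : 625 / 2 ≤ r) {i : ℕ} (hi : i < m) :
    ‖S (i + 1) - S i‖ ≤ gflBound 1 (2 * r) m (min (i + 1) (m - i)) := by
  have hr0 : 0 < r := by linarith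
  set B : ℕ → ℝ := fun k => gflBound 1 (2 * r) m (min (k + 1) (m - k)) with hBdef
  have hB : ∀ k, 0 < B k := fun k => gflBound_pos hr0 _ _
  -- If the bound fails anywhere, it fails where the ratio is maximal, and there the other steps are
  -- controlled.
  obtain ⟨j, hj, hjmax⟩ := Finset.exists_max_image (Finset.range m)
    (fun k => ‖S (k + 1) - S k‖ / B k) ⟨i, Finset.mem_range.2 hi⟩
  rw [Finset.mem_range] at hj
  by_contra! hcon
  set v := ‖S (j + 1) - S j‖ with hv
  have hvB : B j < v := by
    have h1 : 1 < ‖S (i + 1) - S i‖ / B i := (one_lt_div (hB i)).2 hcon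
    exact (one_lt_div (hB j)).1 (h1.trans_le (hjmax i (Finset.mem_range.2 hi)))
  have hmax : ∀ k < m, ∀ q : ℝ, 1 ≤ q →
      ((min (j + 1) (m - j) : ℕ) : ℝ) ≤ q ^ 2 * (min (k + 1) (m - k) : ℕ) →
      ‖S (k + 1) - S k‖ ≤ q * v := by
    intro k hk q hq hle
    have h1 : B k ≤ q * B j := gflBound_le_mul hr0 hq (by omega) (by omega) hle
    have h2 := hjmax k (Finset.mem_range.2 hk)
    rw [div_le_iff₀ (hB k)] at h2
    refine h2.trans ?_
    rw [div_mul_eq_mul_div, div_le_iff₀ (hB j)]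
    have := mul_le_mul_of_nonneg_left h1 (norm_nonneg (S (j + 1) - S j))
    linarith
  have hv0 : 0 < v := (hB j).trans hvB
  have hm0 : (0 : ℝ) < m := by exact_mod_cast (by omega : 0 < m)
  rw [hBdef] at hvB
  dsimp only at hvB
  rw [gflBound_one, max_lt_iff, max_lt_iff, max_lt_iff] at hvB
  obtain ⟨⟨ha, -⟩, hb, hc⟩ := hvB
  have hd0 : (0 : ℝ) < (min (j + 1) (m - j) : ℕ) := by
    exact_mod_cast (by omega : 0 < min (j + 1) (m - j))
  have hv3 : 8 * r < v * m := by
    rw [div_lt_iff₀ hm0] at ha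
    linarith [Real.sqrt_nonneg ((m : ℝ) / 2)]
  have hv1 : 3125 < v ^ 2 * (min (j + 1) (m - j) : ℕ) := by
    have := pow_lt_pow_left₀ hb (by positivity) two_ne_zero
    rw [div_pow, mul_pow, Real.sq_sqrt hd0.le, Real.sq_sqrt (by norm_num),
      div_lt_iff₀ hd0] at this
    linarith
  have hv2 : 15625 < v ^ 2 * (2 * r) := by
    have := pow_lt_pow_left₀ hc (by positivity) two_ne_zero
    rw [mul_pow, Real.sq_sqrt (by positivity), mul_one_div, div_lt_iff₀ (by positivity)] at this
    linarith
  rcases le_or_gt (2 * j + 1) m with hjm | hjm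
  · rw [show min (j + 1) (m - j) = j + 1 by omega] at hv1 hmax
    push_cast at hv1
    exact h.no_maximal_fast_step hjm rfl hr hv1 hv2 hv3 hmax
  · have hsym : ∀ k < m, ‖-S (m - (k + 1)) - -S (m - k)‖ =
        ‖S (m - 1 - k + 1) - S (m - 1 - k)‖ := by
      intro k hk
      rw [show m - 1 - k + 1 = m - k by omega, show m - 1 - k = m - (k + 1) by omega]
      congr 1
      abel
    rw [show min (j + 1) (m - j) = m - 1 - j + 1 by omega] at hv1 hmax
    push_cast at hv1
    refine h.reverse.no_maximal_fast_step (i := m - 1 - j) (by omega) ?_ hr hv1 hv2 hv3 ?_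
    · rw [hsym _ (by omega), show m - 1 - (m - 1 - j) = j by omega]
    · intro k hk q hq hle
      rw [hsym k hk]
      refine hmax _ (by omega) q hq ?_
      rwa [show min (m - 1 - k + 1) (m - (m - 1 - k)) = min (k + 1) (m - k) by omega]

end TautPath

/-! ### Optimality conditions of the group fused lasso -/

/-- The sum of `f i` over the indices `i < j`. -/
def prefixSum {E : Type*} [AddCommMonoid E] {n : ℕ} (f : Fin n → E) (j : ℕ) : E :=
  ∑ i : Fin n, if i.val < j then f i else 0

theorem prefixSum_zero {E : Type*} [AddCommMonoid E] {n : ℕ} (f : Fin n → E) :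
    prefixSum f 0 = 0 := by simp [prefixSum]

theorem prefixSum_succ {E : Type*} [AddCommMonoid E] {n : ℕ} (f : Fin n → E) {j : ℕ}
    (hj : j < n) : prefixSum f (j + 1) = prefixSum f j + f ⟨j, hj⟩ := by
  have h : f ⟨j, hj⟩ = ∑ i : Fin n, if i = ⟨j, hj⟩ then f i else 0 := by simp
  rw [h, prefixSum, prefixSum, ← Finset.sum_add_distrib]
  refine Finset.sum_congr rfl fun i _ => ?_
  rcases lt_trichotomy i.val j with h1 | h1 | h1
  · have : i ≠ ⟨j, hj⟩ := fun e => by simp [e] at h1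
    simp [this, h1, h1.trans (Nat.lt_succ_self j)]
  · have : i = ⟨j, hj⟩ := Fin.ext h1
    simp [this]
  · have h2 : i ≠ ⟨j, hj⟩ := fun e => by simp [e] at h1
    have h3 : ¬ i.val < j + 1 := by omega
    have h4 : ¬ i.val < j := by omega
    simp [h2, h3, h4]

theorem prefixSum_sub {E : Type*} [AddCommGroup E] {n : ℕ} (f g : Fin n → E) (j : ℕ) :
    prefixSum (fun i => f i - g i) j = prefixSum f j - prefixSum g j := by
  rw [prefixSum, prefixSum, prefixSum, ← Finset.sum_sub_distrib]
  refine Finset.sum_congr rfl fun i _ => ?_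
  split_ifs <;> simp

theorem nonneg_of_forall_add_mul_nonneg {A B : ℝ}
    (h : ∀ s : ℝ, 0 < s → s ≤ 1 → 0 ≤ A + s * B) : 0 ≤ A := by
  by_contra! hA
  have h1 := h 1 one_pos le_rfl
  have hB : 0 < B := by linarith
  have h2 := h (-A / (2 * B)) (div_pos (by linarith) (by linarith))
    ((div_le_one (by linarith)).2 (by linarith))
  have h3 : -A / (2 * B) * B = -A / 2 := by field_simp
  linarith

section FirstOrder

variable {E : Type*} [NormedAddCommGroup E] [InnerProductSpace ℝ E]

/-- First-order condition in the direction `-g`; the next lemma uses the direction `-a`. -/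
theorem norm_le_of_step_nonneg {g a : E} {lam N : ℝ} (hlam : 0 < lam)
    (h : ∀ w : E, 0 ≤ 2 * ⟪g, w⟫_ℝ + N * ‖w‖ ^ 2 + lam * (‖a + w‖ - ‖a‖)) :
    ‖g‖ ≤ lam / 2 := by
  have h1 : 0 ≤ -2 * ‖g‖ ^ 2 + lam * ‖g‖ := by
    apply nonneg_of_forall_add_mul_nonneg (B := N * ‖g‖ ^ 2)
    intro s hs _
    have h2 := h (s • -g)
    have h3 : ‖a + s • -g‖ ≤ ‖a‖ + s * ‖g‖ := by
      refine (norm_add_le _ _).trans (le_of_eq ?_)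
      rw [norm_smul, norm_neg, Real.norm_of_nonneg hs.le]
    rw [real_inner_smul_right, inner_neg_right, real_inner_self_eq_norm_sq, norm_smul, norm_neg,
      Real.norm_of_nonneg hs.le] at h2
    have h4 : lam * (‖a + s • -g‖ - ‖a‖) ≤ lam * (s * ‖g‖) :=
      mul_le_mul_of_nonneg_left (by linarith) hlam.le
    have h5 : 0 ≤ s * (-2 * ‖g‖ ^ 2 + lam * ‖g‖ + s * (N * ‖g‖ ^ 2)) := by nlinarith
    exact nonneg_of_mul_nonneg_right h5 hs
  rcases (norm_nonneg g).eq_or_lt with h0 | h0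
  · rw [← h0]; linarith
  · have h6 : 0 ≤ ‖g‖ * (lam - 2 * ‖g‖) := by nlinarith
    have := nonneg_of_mul_nonneg_right h6 h0
    linarith

theorem inner_le_of_step_nonneg {g a : E} {lam N : ℝ}
    (h : ∀ w : E, 0 ≤ 2 * ⟪g, w⟫_ℝ + N * ‖w‖ ^ 2 + lam * (‖a + w‖ - ‖a‖)) :
    ⟪g, a⟫_ℝ ≤ -(lam / 2) * ‖a‖ := by
  have h1 : 0 ≤ -2 * ⟪g, a⟫_ℝ - lam * ‖a‖ := by
    apply nonneg_of_forall_add_mul_nonneg (B := N * ‖a‖ ^ 2)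
    intro s hs hs1
    have h2 := h (s • -a)
    have h3 : ‖a + s • -a‖ = ‖a‖ - s * ‖a‖ := by
      rw [show a + s • -a = (1 - s) • a by module, norm_smul, Real.norm_of_nonneg (by linarith)]
      ring
    rw [real_inner_smul_right, inner_neg_right, h3, norm_smul, norm_neg,
      Real.norm_of_nonneg hs.le] at h2
    have h5 : 0 ≤ s * (-2 * ⟪g, a⟫_ℝ - lam * ‖a‖ + s * (N * ‖a‖ ^ 2)) := by nlinarith
    exact nonneg_of_mul_nonneg_right h5 hs
  linarith

/-- Equality case of Cauchy–Schwarz: the hypotheses force `(lam / 2) • a + ‖a‖ • g = 0`. -/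
theorem neg_eq_smul_of_inner_le {g a : E} {lam : ℝ} (hlam : 0 < lam) (hg : ‖g‖ ≤ lam / 2)
    (h : ⟪g, a⟫_ℝ ≤ -(lam / 2) * ‖a‖) :
    -a = (2 * ‖a‖ / lam) • g ∧ 2 * ‖a‖ / lam * (‖g‖ - lam / 2) = 0 := by
  have h1 : ‖(lam / 2) • a + ‖a‖ • g‖ ^ 2 ≤ 0 := by
    rw [norm_add_sq_real, norm_smul, norm_smul, real_inner_smul_left, real_inner_smul_right,
      real_inner_comm, norm_norm, Real.norm_of_nonneg (by linarith)]
    have h2 : ‖g‖ ^ 2 ≤ (lam / 2) ^ 2 := pow_le_pow_left₀ (norm_nonneg _) hg 2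
    have h3 := mul_le_mul_of_nonneg_left h2 (sq_nonneg ‖a‖)
    have h4 := mul_le_mul_of_nonneg_left h (show 0 ≤ lam * ‖a‖ by positivity)
    nlinarith
  have h2 : (lam / 2) • a + ‖a‖ • g = 0 := by
    rw [← norm_eq_zero]
    exact pow_eq_zero_iff two_ne_zero |>.1 (le_antisymm h1 (sq_nonneg _))
  have h3 : -a = (2 * ‖a‖ / lam) • g := by
    have : -a = (2 / lam) • (-((lam / 2) • a)) := by
      rw [smul_neg, smul_smul, show 2 / lam * (lam / 2) = 1 by field_simp, one_smul]
    rw [this, ← eq_neg_of_add_eq_zero_right h2, smul_smul]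
    congr 1
    ring
  refine ⟨h3, ?_⟩
  have h4 : ‖a‖ = 2 * ‖a‖ / lam * ‖g‖ := by
    have := congrArg norm h3
    rwa [norm_neg, norm_smul, Real.norm_of_nonneg (by positivity)] at this
  rw [mul_sub, ← h4]
  field_simp
  ring

end FirstOrder

section KKT

variable {n p : ℕ} {lam : ℝ} {y z : Fin n → EuclideanSpace ℝ (Fin p)}

/-- Moving the first `j` vectors by a common `w` alters only the difference across boundary `j`. The
quadratic term is bounded crudely, since only first order matters. -/
theorem gflObjective_add_step_le (y z : Fin n → EuclideanSpace ℝ (Fin p)) (j : ℕ)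
    (w : EuclideanSpace ℝ (Fin p)) :
    gflObjective lam y (fun i => z i + if i.val < j then w else 0) ≤
      gflObjective lam y z + (2 * ⟪prefixSum (fun i => z i - y i) j, w⟫_ℝ + n * ‖w‖ ^ 2 +
        lam * ∑ k : Fin (n - 1),
          (‖z ⟨k.val, by have := k.isLt; omega⟩ - z ⟨k.val + 1, by have := k.isLt; omega⟩ +
              (if k.val + 1 = j then w else 0)‖ -
            ‖z ⟨k.val, by have := k.isLt; omega⟩ - z ⟨k.val + 1, by have := k.isLt; omega⟩‖)) := by
  have h1 : ∑ i : Fin n, ‖y i - (z i + if i.val < j then w else 0)‖ ^ 2 ≤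
      ∑ i : Fin n, ‖y i - z i‖ ^ 2 +
        (2 * ⟪prefixSum (fun i => z i - y i) j, w⟫_ℝ + n * ‖w‖ ^ 2) := by
    have e1 : (n : ℝ) * ‖w‖ ^ 2 = ∑ _i : Fin n, ‖w‖ ^ 2 := by simp
    rw [e1, prefixSum, sum_inner, Finset.mul_sum, ← Finset.sum_add_distrib,
      ← Finset.sum_add_distrib]
    refine Finset.sum_le_sum fun i _ => ?_
    split_ifs with hij
    · rw [show y i - (z i + w) = (y i - z i) - w by abel, norm_sub_sq_real, ← neg_sub (y i) (z i),
        inner_neg_left]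
      linarith
    · simp
  have h2 : ∀ k : Fin (n - 1),
      (z ⟨k.val, by have := k.isLt; omega⟩ + if k.val < j then w else 0) -
        (z ⟨k.val + 1, by have := k.isLt; omega⟩ + if k.val + 1 < j then w else 0) =
      z ⟨k.val, by have := k.isLt; omega⟩ - z ⟨k.val + 1, by have := k.isLt; omega⟩ +
        (if k.val + 1 = j then w else 0) := by
    intro k
    rcases lt_trichotomy (k.val + 1) j with h | h | h
    · rw [if_pos (by omega), if_pos h, if_neg (by omega)]; abel
    · rw [if_pos (by omega), if_neg (by omega), if_pos h]; abel
    · rw [if_neg (by omega), if_neg (by omega), if_neg (by omega)]; abel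
  rw [gflObjective, gflObjective]
  dsimp only
  simp only [h2, Finset.sum_sub_distrib]
  linarith

theorem IsGFLSolution.step_nonneg (h : IsGFLSolution lam y z) {j : ℕ} (hj : j + 1 < n)
    (w : EuclideanSpace ℝ (Fin p)) :
    0 ≤ 2 * ⟪prefixSum (fun i => z i - y i) (j + 1), w⟫_ℝ + n * ‖w‖ ^ 2 +
      lam * (‖z ⟨j, by omega⟩ - z ⟨j + 1, hj⟩ + w‖ - ‖z ⟨j, by omega⟩ - z ⟨j + 1, hj⟩‖) := by
  have h1 := (h _).trans (gflObjective_add_step_le (lam := lam) y z (j + 1) w)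
  rw [Finset.sum_eq_single (⟨j, by omega⟩ : Fin (n - 1))] at h1
  · simp only [if_true] at h1
    linarith
  · intro k _ hk
    have : ¬ k.val + 1 = j + 1 := fun e => hk (Fin.ext (by simpa using e))
    rw [if_neg this, add_zero, sub_self]
  · simp

theorem IsGFLSolution.prefixSum_eq_zero (h : IsGFLSolution lam y z) :
    prefixSum (fun i => z i - y i) n = 0 := by
  have h1 : ∀ w, 0 ≤ 2 * ⟪prefixSum (fun i => z i - y i) n, w⟫_ℝ + n * ‖w‖ ^ 2 := by
    intro w
    have h1 := (h _).trans (gflObjective_add_step_le (lam := lam) y z n w)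
    rw [Finset.sum_eq_zero] at h1
    · linarith
    · intro k _
      have : ¬ k.val + 1 = n := by have := k.isLt; omega
      simp [this]
  set g := prefixSum (fun i => z i - y i) n
  have h2 : 0 ≤ -2 * ‖g‖ ^ 2 := by
    apply nonneg_of_forall_add_mul_nonneg (B := n * ‖g‖ ^ 2)
    intro s hs _
    have h2 := h1 (s • -g)
    rw [real_inner_smul_right, inner_neg_right, real_inner_self_eq_norm_sq, norm_smul, norm_neg,
      Real.norm_of_nonneg hs.le] at h2
    have h5 : 0 ≤ s * (-2 * ‖g‖ ^ 2 + s * (n * ‖g‖ ^ 2)) := by nlinarith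
    exact nonneg_of_mul_nonneg_right h5 hs
  rw [← norm_eq_zero]
  exact pow_eq_zero_iff two_ne_zero |>.1 (le_antisymm (by linarith) (sq_nonneg _))

theorem IsGFLSolution.norm_prefixSum_le (h : IsGFLSolution lam y z) (hlam : 0 < lam) {j : ℕ}
    (hj : j ≤ n) : ‖prefixSum (fun i => z i - y i) j‖ ≤ lam / 2 := by
  rcases hj.eq_or_lt with rfl | hj
  · rw [h.prefixSum_eq_zero, norm_zero]; linarith
  rcases j with _ | j
  · rw [prefixSum_zero, norm_zero]; linarith
  · exact norm_le_of_step_nonneg hlam (h.step_nonneg hj)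

theorem IsGFLSolution.exists_multiplier (h : IsGFLSolution lam y z) (hlam : 0 < lam) :
    ∃ c : ℕ → ℝ, (∀ j, 0 ≤ c j) ∧
      (∀ j, c j * (‖prefixSum (fun i => z i - y i) j‖ - lam / 2) = 0) ∧
      ∀ j (hj : j + 1 < n), z ⟨j + 1, hj⟩ - z ⟨j, by omega⟩ =
        c (j + 1) • prefixSum (fun i => z i - y i) (j + 1) := by
  have key : ∀ j, ∃ c : ℝ, 0 ≤ c ∧ c * (‖prefixSum (fun i => z i - y i) j‖ - lam / 2) = 0 ∧
      ∀ k (hk : k + 1 < n), j = k + 1 → z ⟨k + 1, hk⟩ - z ⟨k, by omega⟩ =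
        c • prefixSum (fun i => z i - y i) (k + 1) := by
    intro j
    by_cases hj : ∃ k, k + 1 < n ∧ j = k + 1
    · obtain ⟨k, hk, rfl⟩ := hj
      obtain ⟨h1, h2⟩ := neg_eq_smul_of_inner_le hlam (h.norm_prefixSum_le hlam hk.le)
        (inner_le_of_step_nonneg (h.step_nonneg hk))
      refine ⟨_, by positivity, h2, fun l hl e => ?_⟩
      obtain rfl : k = l := by omega
      rw [← h1, neg_sub]
    · push Not at hj
      -- At boundaries that are not interior the multiplier is set to `0`.
      exact ⟨0, le_rfl, zero_mul _, fun k hk e => absurd e (hj k hk)⟩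
  choose c hc using key
  exact ⟨c, fun j => (hc j).1, fun j => (hc j).2.1, fun j hj => (hc (j + 1)).2.2 j hj rfl⟩

theorem gflBound_eq_mul {M : ℝ} (hM : 0 < M) (lam : ℝ) (m d : ℕ) :
    gflBound M lam m d = M * gflBound 1 (lam / M) m d := by
  have h1 : √(M ^ 3 / lam) = M * √(1 / (lam / M)) := by
    rw [show M ^ 3 / lam = M ^ 2 * (1 / (lam / M)) by field_simp, Real.sqrt_mul (sq_nonneg M),
      Real.sqrt_sq hM.le]
  rw [gflBound, gflBound, mul_max_of_nonneg _ _ hM.le, mul_max_of_nonneg _ _ hM.le,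
    mul_max_of_nonneg _ _ hM.le, one_pow, h1]
  congr 2
  · rw [one_mul, show M * √((m : ℝ) / 2) + lam = M * (√((m : ℝ) / 2) + lam / M) by field_simp]
    ring
  · ring
  · ring
  · ring

/-- The error bound for the group fused lasso when the sums of the noise over all intervals are of
the order of the square root of the length of the interval. -/
theorem IsGFLSolution.norm_sub_le {x ε : Fin n → EuclideanSpace ℝ (Fin p)}
    (h : IsGFLSolution lam (fun i => x i + ε i) z) {M : ℝ} (hM : 0 < M) (hlam : 25 ^ 2 * M ≤ lam)
    {K : ℕ} (S : Segmentation n K) (hx : S.IsConstOn x)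
    (hε : ∀ a b, a < b → b ≤ n → ‖prefixSum ε b - prefixSum ε a‖ ≤ M * √((b : ℝ) - a))
    (k : Fin K) (i : Fin n) (hi : S.Mem k i) :
    ‖z i - x i‖ ≤ gflBound M lam (S.len k) (S.dist k i) := by
  have hlam0 : 0 < lam := lt_of_lt_of_le (by positivity) hlam
  obtain ⟨c, hc0, hc1, hc2⟩ := h.exists_multiplier hlam0
  set A := S.start k.castSucc with hA
  set m := S.len k with hm
  have hB : A + m = S.start k.succ := by
    have := S.start_strictMono.monotone (Fin.castSucc_lt_succ (i := k)).le
    rw [hm, Segmentation.len]; omega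
  have hBn : A + m ≤ n := by
    rw [hB]
    exact (S.start_strictMono.monotone (Fin.le_last _)).trans S.start_last.le
  set G := prefixSum (fun i => z i - (x i + ε i)) with hG
  have hGe : ∀ j, prefixSum (fun i => z i - x i) j - G j = prefixSum ε j := by
    intro j
    rw [hG, ← prefixSum_sub]
    congr 1
    funext i
    abel
  have hpath : TautPath (lam / M / 2) m (fun j => M⁻¹ • prefixSum (fun i => z i - x i) (A + j))
      (fun j => M⁻¹ • G (A + j)) (fun j => c (A + j)) := by
    constructor
    · intro j hj
      have := h.norm_prefixSum_le hlam0 (j := A + j) (by omega)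
      rw [norm_smul, Real.norm_of_nonneg (by positivity), inv_mul_le_iff₀ hM]
      refine this.trans (le_of_eq ?_)
      field_simp
    · intro a b hab hb
      rcases hab.eq_or_lt with rfl | hab
      · simp
      have := hε (A + a) (A + b) (by omega) (by omega)
      rw [← hGe, ← hGe] at this
      rw [← smul_sub, ← smul_sub, ← smul_sub, norm_smul, Real.norm_of_nonneg (by positivity),
        inv_mul_le_iff₀ hM]
      push_cast at this
      rw [add_sub_add_left_eq_sub] at this
      rwa [sub_sub_sub_comm]
    · exact fun j => hc0 _
    · intro j
      have := hc1 (A + j)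
      rw [norm_smul, Real.norm_of_nonneg (by positivity)]
      calc _ = M⁻¹ * (c (A + j) * (‖G (A + j)‖ - lam / 2)) := by ring
        _ = 0 := by rw [this, mul_zero]
    · intro j hj
      have e1 := prefixSum_succ (fun i => z i - x i) (j := A + j) (by omega)
      have e2 := prefixSum_succ (fun i => z i - x i) (j := A + j + 1) (by omega)
      have e3 := hx k ⟨A + j, by omega⟩ ⟨A + j + 1, by omega⟩
        ⟨by simp [hA], by rw [← hB]; simp; omega⟩ ⟨by simp [hA]; omega, by rw [← hB]; simp; omega⟩
      have e4 := hc2 (A + j) (by omega)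
      rw [← smul_sub, ← smul_sub, ← smul_sub, smul_comm (c (A + (j + 1)))]
      congr 1
      rw [show A + (j + 2) = A + j + 1 + 1 by ring, show A + (j + 1) = A + j + 1 by ring, e2, e1,
        ← e4, e3]
      abel
  have hj : ∃ j, i.val = A + j := ⟨i.val - A, by have := hi.1; omega⟩
  obtain ⟨j, hj⟩ := hj
  have hjm : j < m := by have := hi.2; omega
  have hr : (625 / 2 : ℝ) ≤ lam / M / 2 := by
    have : 625 ≤ lam / M := by rw [le_div_iff₀ hM]; linarith
    linarith
  have hfin := hpath.norm_increment_le hr hjm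
  rw [show A + (j + 1) = A + j + 1 by ring, prefixSum_succ _ (show A + j < n by omega), ← smul_sub,
    add_sub_cancel_left, norm_smul, Real.norm_of_nonneg (by positivity), inv_mul_le_iff₀ hM,
    show 2 * (lam / M / 2) = lam / M by ring, ← gflBound_eq_mul hM] at hfin
  have hi' : i = ⟨A + j, by omega⟩ := Fin.ext hj
  have hd : S.dist k i = min (j + 1) (m - j) := by
    rw [Segmentation.dist, hj, ← hB, ← hA]; omega
  rw [hd, hi']
  exact hfin

end KKT

/-! ### Gaussian tails and the noise over intervals -/

theorem integral_exp_sq_gaussianReal :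
    ∫ x, Real.exp (3 / 8 * x ^ 2) ∂gaussianReal 0 1 = 2 := by
  rw [integral_gaussianReal_eq_integral_smul one_ne_zero]
  have h : ∀ x : ℝ, gaussianPDFReal 0 1 x • Real.exp (3 / 8 * x ^ 2) =
      (√(2 * Real.pi))⁻¹ * Real.exp (-(1 / 8) * x ^ 2) := by
    intro x
    rw [gaussianPDFReal, smul_eq_mul, mul_assoc, ← Real.exp_add]
    simp only [NNReal.coe_one, mul_one, sub_zero]
    congr 2
    ring
  simp_rw [h]
  rw [integral_const_mul, integral_gaussian, ← Real.sqrt_inv, ← Real.sqrt_mul (by positivity)]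
  rw [show (2 * Real.pi)⁻¹ * (Real.pi / (1 / 8)) = 2 ^ 2 by field_simp; norm_num]
  exact Real.sqrt_sq (by norm_num)

section StdGaussian

variable {p : ℕ}

theorem exp_sq_norm_toLp (x : Fin p → ℝ) :
    Real.exp (3 / 8 * ‖WithLp.toLp 2 x‖ ^ 2) = ∏ i, Real.exp (3 / 8 * x i ^ 2) := by
  rw [EuclideanSpace.real_norm_sq_eq, Finset.mul_sum, Real.exp_sum]

theorem integral_exp_sq_stdGaussian :
    ∫ x, Real.exp (3 / 8 * ‖x‖ ^ 2) ∂stdGaussian (EuclideanSpace ℝ (Fin p)) = 2 ^ p := by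
  rw [← map_pi_eq_stdGaussian, integral_map (by fun_prop) (by fun_prop)]
  simp_rw [exp_sq_norm_toLp]
  rw [integral_fintype_prod_eq_pow (fun x : ℝ => Real.exp (3 / 8 * x ^ 2)),
    integral_exp_sq_gaussianReal, Fintype.card_fin]

/-- A non-integrable function would have integral `0`, not `2 ^ p`. -/
theorem integrable_exp_sq_stdGaussian :
    Integrable (fun x => Real.exp (3 / 8 * ‖x‖ ^ 2)) (stdGaussian (EuclideanSpace ℝ (Fin p))) := by
  by_contra h
  have := integral_undef h
  rw [integral_exp_sq_stdGaussian] at this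
  exact absurd this (by positivity)

theorem stdGaussian_real_norm_ge_le {s : ℝ} (hs : 0 ≤ s) :
    (stdGaussian (EuclideanSpace ℝ (Fin p))).real {x | s ≤ ‖x‖} ≤
      2 ^ p * Real.exp (-(3 / 8 * s ^ 2)) := by
  have h1 := mul_meas_ge_le_integral_of_nonneg (μ := stdGaussian (EuclideanSpace ℝ (Fin p)))
    (f := fun x => Real.exp (3 / 8 * ‖x‖ ^ 2)) (Filter.Eventually.of_forall fun x => by positivity)
    integrable_exp_sq_stdGaussian (Real.exp (3 / 8 * s ^ 2))
  rw [integral_exp_sq_stdGaussian] at h1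
  have h2 : {x : EuclideanSpace ℝ (Fin p) | s ≤ ‖x‖} ⊆
      {x | Real.exp (3 / 8 * s ^ 2) ≤ Real.exp (3 / 8 * ‖x‖ ^ 2)} := by
    intro x hx
    have := pow_le_pow_left₀ hs (show s ≤ ‖x‖ from hx) 2
    exact Real.exp_le_exp.2 (by linarith)
  have h3 := measureReal_mono (μ := stdGaussian (EuclideanSpace ℝ (Fin p))) h2
  rw [Real.exp_neg, ← div_eq_mul_inv, le_div_iff₀ (Real.exp_pos _), mul_comm]
  exact (mul_le_mul_of_nonneg_left h3 (Real.exp_pos _).le).trans h1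

/-- The Gaussian tail at the noise level. -/
theorem two_pow_mul_exp_le {n : ℕ} {t s : ℝ} (hn : 0 < n) (ht : 0 < t)
    (h1 : 8 * (Real.log n + Real.log t) + p ≤ s ^ 2) (h2 : 4 * (p : ℝ) ≤ s ^ 2) :
    (2 : ℝ) ^ p * Real.exp (-(3 / 8 * s ^ 2)) ≤ 1 / (n * t) ^ 2 := by
  have hn' : (0 : ℝ) < n := by exact_mod_cast hn
  have hnt : (0 : ℝ) < (n * t) ^ 2 := by positivity
  have h3 : (2 : ℝ) ^ p = Real.exp (p * Real.log 2) := by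
    rw [mul_comm, Real.exp_mul, Real.exp_log two_pos, Real.rpow_natCast]
  have h4 : 1 / (n * t) ^ 2 = Real.exp (-(2 * (Real.log n + Real.log t))) := by
    rw [Real.exp_neg, ← Real.log_mul hn'.ne' ht.ne', one_div, two_mul, Real.exp_add,
      Real.exp_log (by positivity), sq]
  rw [h3, h4, ← Real.exp_add]
  apply Real.exp_le_exp.2
  -- A quarter of `h1` plus an eighth of `h2` gives `3/8 s² ≥ 2 (log n + log t) + 3/4 p`, and `log 2
  -- < 3/4`.
  have h5 : (p : ℝ) * Real.log 2 ≤ p * (3 / 4) :=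
    mul_le_mul_of_nonneg_left (by linarith [Real.log_two_lt_d9]) (Nat.cast_nonneg _)
  linarith

end StdGaussian

section Noise

variable {Ω : Type*} [MeasurableSpace Ω] {μ : Measure Ω} [IsProbabilityMeasure μ]
  {n p : ℕ} {σ : ℝ} {ε : Fin n → Ω → EuclideanSpace ℝ (Fin p)}

theorem charFun_multivariateGaussian_smul_one (σ : ℝ) (x : EuclideanSpace ℝ (Fin p)) :
    charFun (multivariateGaussian 0 (σ ^ 2 • (1 : Matrix (Fin p) (Fin p) ℝ))) x =
      Complex.exp (-(σ ^ 2 * ‖x‖ ^ 2 / 2 : ℝ)) := by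
  rw [charFun_multivariateGaussian (Matrix.PosSemidef.one.smul (sq_nonneg σ))]
  congr 1
  have h : x.ofLp ⬝ᵥ x.ofLp = ‖x‖ ^ 2 := by
    rw [EuclideanSpace.real_norm_sq_eq, dotProduct]
    exact Finset.sum_congr rfl fun _ _ => (sq _).symm
  rw [Matrix.smul_mulVec, Matrix.one_mulVec, dotProduct_smul, h]
  simp

/-- A sum of independent centered isotropic Gaussian vectors. -/
theorem hasLaw_sum_gaussian
    (hε : ∀ i, HasLaw (ε i) (multivariateGaussian 0 (σ ^ 2 • (1 : Matrix (Fin p) (Fin p) ℝ))) μ)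
    (hindep : iIndepFun ε μ) (s : Finset (Fin n)) :
    HasLaw (∑ i ∈ s, ε i)
      ((stdGaussian (EuclideanSpace ℝ (Fin p))).map fun x => (σ * √(s.card : ℝ)) • x) μ where
  aemeasurable := Finset.aemeasurable_sum s fun i _ => (hε i).aemeasurable
  map_eq := by
    have hm : AEMeasurable (∑ i ∈ s, ε i) μ :=
      Finset.aemeasurable_sum s fun i _ => (hε i).aemeasurable
    have := Measure.isProbabilityMeasure_map hm
    have : IsProbabilityMeasure ((stdGaussian (EuclideanSpace ℝ (Fin p))).map
        fun x => (σ * √(s.card : ℝ)) • x) := Measure.isProbabilityMeasure_map (by fun_prop)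
    apply Measure.ext_of_charFun
    ext x
    rw [charFun_eq_charFunDual_toDualMap, iIndepFun.charFunDual_map_finsetSum_eq_prod
      (fun i _ => (hε i).aemeasurable) (hindep.restrict s), Finset.prod_apply, charFun_map_smul,
      charFun_stdGaussian]
    simp_rw [← charFun_eq_charFunDual_toDualMap, (hε _).map_eq,
      charFun_multivariateGaussian_smul_one]
    rw [Finset.prod_const, ← Complex.exp_nat_mul, norm_smul, ← Complex.ofReal_pow, mul_pow,
      Real.norm_eq_abs, sq_abs, mul_pow, Real.sq_sqrt (Nat.cast_nonneg _)]
    congr 1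
    push_cast
    ring

theorem prefixSum_sub_eq_sum {E : Type*} [AddCommGroup E] (f : Fin n → E) {a b : ℕ}
    (hab : a ≤ b) : prefixSum f b - prefixSum f a =
      ∑ i ∈ Finset.univ.filter (fun i : Fin n => a ≤ i.val ∧ i.val < b), f i := by
  rw [prefixSum, prefixSum, ← Finset.sum_sub_distrib, Finset.sum_filter]
  refine Finset.sum_congr rfl fun i _ => ?_
  rcases lt_or_ge i.val a with h | h
  · rw [if_pos (by omega), if_pos h, if_neg (by omega), sub_self]
  · rw [if_neg (by omega : ¬ i.val < a), sub_zero]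
    simp [h]

theorem card_filter_val_mem_Ico {a b : ℕ} (hb : b ≤ n) :
    (Finset.univ.filter (fun i : Fin n => a ≤ i.val ∧ i.val < b)).card = b - a := by
  rw [← Nat.card_Ico, ← Finset.card_map Fin.valEmbedding]
  congr 1
  ext j
  simp only [Finset.mem_map, Finset.mem_filter, Finset.mem_univ, true_and, Fin.valEmbedding_apply,
    Finset.mem_Ico]
  exact ⟨fun ⟨i, hi, e⟩ => e ▸ hi, fun hj => ⟨⟨j, by omega⟩, hj, rfl⟩⟩

/-- The sum of the noise over one interval rarely exceeds the noise level. -/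
theorem measureReal_norm_prefixSum_gt_le (hσ : 0 < σ)
    (hε : ∀ i, HasLaw (ε i) (multivariateGaussian 0 (σ ^ 2 • (1 : Matrix (Fin p) (Fin p) ℝ))) μ)
    (hindep : iIndepFun ε μ) {t : ℝ} (ht : 0 < t) {a b : ℕ} (hab : a < b) (hb : b ≤ n)
    (hnt : 0 ≤ Real.log n + Real.log t) :
    μ.real {ω | gflNoiseLevel n p σ t * √((b : ℝ) - a) <
      ‖prefixSum (fun i => ε i ω) b - prefixSum (fun i => ε i ω) a‖} ≤ 1 / (n * t) ^ 2 := by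
  set s := Finset.univ.filter (fun i : Fin n => a ≤ i.val ∧ i.val < b) with hs
  have hcard : (s.card : ℝ) = (b : ℝ) - a := by
    rw [card_filter_val_mem_Ico hb, Nat.cast_sub hab.le]
  have hba : (0 : ℝ) < (b : ℝ) - a := sub_pos.2 (by exact_mod_cast hab)
  set q := max (√(8 * (Real.log n + Real.log t) + p)) (2 * √(p : ℝ)) with hq
  have hM : gflNoiseLevel n p σ t = σ * q := rfl
  have hq0 : 0 ≤ q := le_max_of_le_left (Real.sqrt_nonneg _)
  have hrw : {ω | gflNoiseLevel n p σ t * √((b : ℝ) - a) <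
      ‖prefixSum (fun i => ε i ω) b - prefixSum (fun i => ε i ω) a‖} =
      {ω | σ * q * √((b : ℝ) - a) < ‖(∑ i ∈ s, ε i) ω‖} := by
    simp only [hM, prefixSum_sub_eq_sum _ hab.le, Finset.sum_apply, hs]
  rw [hrw, (hasLaw_sum_gaussian hε hindep s).measureReal_eq
    (p := fun x => σ * q * √((b : ℝ) - a) < ‖x‖) (measurableSet_lt (by fun_prop) (by fun_prop)),
    map_measureReal_apply (by fun_prop) (measurableSet_lt (by fun_prop) (by fun_prop))]
  refine le_trans (measureReal_mono ?_) ((stdGaussian_real_norm_ge_le hq0).trans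
    (two_pow_mul_exp_le (by omega) ht ?_ ?_))
  · intro x hx
    have hsq : 0 < √((b : ℝ) - a) := Real.sqrt_pos.2 hba
    simp only [Set.mem_preimage, Set.mem_ofPred_eq, hcard, norm_smul,
      Real.norm_of_nonneg (mul_nonneg hσ.le hsq.le)] at hx ⊢
    have : (σ * √((b : ℝ) - a)) * q < (σ * √((b : ℝ) - a)) * ‖x‖ := by linarith
    exact (lt_of_mul_lt_mul_left this (by positivity)).le
  · have := pow_le_pow_left₀ (Real.sqrt_nonneg _) (le_max_left _ _ : _ ≤ q) 2
    rwa [Real.sq_sqrt (by positivity)] at this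
  · have := pow_le_pow_left₀ (by positivity) (le_max_right _ _ : _ ≤ q) 2
    rw [mul_pow, Real.sq_sqrt (Nat.cast_nonneg _)] at this
    linarith

/-- With high probability the noise level bounds the noise over all intervals. -/
theorem one_sub_le_measureReal_of_noise_le (hσ : 0 < σ)
    (hε : ∀ i, HasLaw (ε i) (multivariateGaussian 0 (σ ^ 2 • (1 : Matrix (Fin p) (Fin p) ℝ))) μ)
    (hindep : iIndepFun ε μ) {t : ℝ} (ht : 1 ≤ t) (hn : 0 < n) {A : Set Ω}
    (hA : ∀ ω, (∀ a b, a < b → b ≤ n →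
      ‖prefixSum (fun i => ε i ω) b - prefixSum (fun i => ε i ω) a‖ ≤
        gflNoiseLevel n p σ t * √((b : ℝ) - a)) → ω ∈ A) :
    1 - 1 / t ^ 2 ≤ μ.real A := by
  have hn' : (1 : ℝ) ≤ n := by exact_mod_cast hn
  have hnt : 0 ≤ Real.log n + Real.log t := add_nonneg (Real.log_nonneg hn') (Real.log_nonneg ht)
  set P := (Finset.range n ×ˢ Finset.range (n + 1)).filter fun ab => ab.1 < ab.2 with hP
  let bad : ℕ × ℕ → Set Ω := fun ab => {ω | gflNoiseLevel n p σ t * √((ab.2 : ℝ) - ab.1) <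
      ‖prefixSum (fun i => ε i ω) ab.2 - prefixSum (fun i => ε i ω) ab.1‖}
  have hcard : P.card ≤ n * n := by
    have : P ⊆ Finset.range n ×ˢ Finset.Ioc 0 n := by
      intro ab hab
      simp only [hP, Finset.mem_filter, Finset.mem_product, Finset.mem_range] at hab
      simp only [Finset.mem_product, Finset.mem_range, Finset.mem_Ioc]
      omega
    simpa using Finset.card_le_card this
  have hbad : μ.real (⋃ ab ∈ P, bad ab) ≤ 1 / t ^ 2 := by
    refine (measureReal_biUnion_finset_le _ _).trans ?_
    refine (Finset.sum_le_card_nsmul _ _ (1 / (n * t) ^ 2) fun ab hab => ?_).trans ?_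
    · simp only [hP, Finset.mem_filter, Finset.mem_product, Finset.mem_range] at hab
      exact measureReal_norm_prefixSum_gt_le hσ hε hindep (by linarith) hab.2 (by omega) hnt
    · rw [nsmul_eq_mul]
      have h1 : (P.card : ℝ) ≤ n * n := by exact_mod_cast hcard
      calc (P.card : ℝ) * (1 / (n * t) ^ 2) ≤ (n * n) * (1 / (n * t) ^ 2) :=
            mul_le_mul_of_nonneg_right h1 (by positivity)
        _ = 1 / t ^ 2 := by field_simp
  -- Covering the whole space and using subadditivity avoids any measurability of `A`, which depends
  -- on an arbitrary choice of minimizers.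
  have hcover : (Set.univ : Set Ω) ⊆ A ∪ ⋃ ab ∈ P, bad ab := by
    intro ω _
    by_cases hω : ω ∈ ⋃ ab ∈ P, bad ab
    · exact Or.inr hω
    · refine Or.inl (hA ω fun a b hab hb => ?_)
      by_contra! hcon
      refine hω (Set.mem_biUnion (x := (a, b)) ?_ hcon)
      simp only [hP, Finset.coe_filter, Finset.mem_product, Finset.mem_range, Set.mem_ofPred_eq]
      omega
  have h1 := (measureReal_mono (μ := μ) hcover).trans (measureReal_union_le _ _)
  rw [probReal_univ] at h1
  linarith

end Noise

/-! ### Conclusion -/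

theorem Segmentation.pos_length {n K : ℕ} (S : Segmentation n K) : 0 < n := by
  have h : S.start 0 < S.start (Fin.last K) := S.start_strictMono (Fin.lt_def.2 S.pos)
  have h1 := S.start_zero
  have h2 := S.start_last
  omega

theorem gflNoiseLevel_pos {n p : ℕ} {σ t : ℝ} (hσ : 0 < σ) (hp : 0 < p) :
    0 < gflNoiseLevel n p σ t :=
  mul_pos hσ (lt_max_of_lt_right (mul_pos two_pos (Real.sqrt_pos.2 (by exact_mod_cast hp))))

theorem gflBound_nonneg (M lam : ℝ) (m d : ℕ) : 0 ≤ gflBound M lam m d :=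
  le_max_of_le_right (le_max_of_le_right (by positivity))

theorem mainTheorem5 {Ω : Type*} [MeasurableSpace Ω] (μ : Measure Ω) [IsProbabilityMeasure μ]
    {n p K : ℕ} (S : Segmentation n K)
    (x : Fin n → EuclideanSpace ℝ (Fin p)) (hx : S.IsConstOn x)
    (σ : ℝ) (hσ : 0 < σ)
    (ε : Fin n → Ω → EuclideanSpace ℝ (Fin p))
    (hε : ∀ i, HasLaw (ε i) (multivariateGaussian 0 (σ ^ 2 • (1 : Matrix (Fin p) (Fin p) ℝ))) μ)
    (hindep : iIndepFun ε μ)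
    (t : ℝ) (ht : 0 < t) (lam : ℝ)
    (hlam_lower : 25 ^ 2 * gflNoiseLevel n p σ t ≤ lam)
    (hlam_upper : ∀ k : Fin K,
      lam < (7 * (S.len k : ℝ) - √(S.len k : ℝ)) * gflNoiseLevel n p σ t)
    (xhat : Ω → Fin n → EuclideanSpace ℝ (Fin p))
    (hxhat : ∀ ω, IsGFLSolution lam (fun i => x i + ε i ω) (xhat ω)) :
    1 - 1 / t ^ 2 ≤ μ.real {ω | ∀ (k : Fin K) (i : Fin n), S.Mem k i →
      ‖xhat ω i - x i‖ ≤ gflBound (gflNoiseLevel n p σ t) lam (S.len k) (S.dist k i)} := by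
  rcases lt_or_ge t 1 with ht1 | ht1
  · have h1 : 1 ≤ 1 / t ^ 2 := (one_le_div (by positivity)).2 (pow_le_one₀ ht.le ht1.le)
    exact (sub_nonpos.2 h1).trans measureReal_nonneg
  refine one_sub_le_measureReal_of_noise_le hσ hε hindep ht1 S.pos_length fun ω hω k i hi => ?_
  -- For `p = 0` the noise level may vanish, so dividing by it is not allowed; but all vectors are
  -- then equal.
  rcases Nat.eq_zero_or_pos p with rfl | hp
  · rw [Subsingleton.elim (xhat ω i - x i) 0, norm_zero]
    exact gflBound_nonneg _ _ _ _
  · exact (hxhat ω).norm_sub_le (gflNoiseLevel_pos hσ hp) hlam_lower S hx hω k i hi
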